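/- Let $d\ge 1$, let $\mathcal{S}_d=\{v\in[0,1]^d:\|v\|_1\le 1\}$ with $\|v\|_1=\sum_{i=1}^d|v_i|$, let $s$ be an interior point of $\mathcal{S}_d$, put $s_{d+1}=1-\|s\|_1$, and let $L\ge 0$. There are constants $C>0$ and $b_0>0$, depending only on $d$, $s$ and $L$, such that the following holds. Let $f:\mathcal{S}_d\to[0,\infty)$ be a probability density with respect to Lebesgue measure which is Lipschitz continuous with constant $L$ for the $\ell^1$ norm, and let $X_1,X_2,\dots$ be independent random vectors with density $f$. For $b>0$ let $$\hat f_{n,b}(s)=\frac1n\sum_{i=1}^n K_{1/b,\;s+b,\;1-\|s\|_1+b}(X_i),$$ where $s+b=(s_1+b,\dots,s_d+b)$ and, for $N>0$, $\alpha\in(0,\infty)^d$, $\beta>0$, $$K_{N,\alpha,\beta}(x)=\frac{\Gamma(N\|\alpha\|_1+N\beta)}{\Gamma(N\beta)\prod_{i=1}^d\Gamma(N\alpha_i)}\,(1-\|x\|_1)^{N\beta-1}\prod_{i=1}^d x_i^{N\alpha_i-1},\qquad x\in\mathcal{S}_d,$$ is the Dirichlet$(N\alpha,N\beta)$ density. Then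 for all $n\ge 1$ and all $0<b<b_0$ the estimator $\hat f_{n,b}(s)$ is square integrable and $$\mathrm{Var}\big(\hat f_{n,b}(s)\big)=\frac{n^{-1}b^{-d/2}\,\big(f(s)+R\big)}{\sqrt{(4\pi)^d\prod_{i=1}^{d+1}s_i}}\qquad\text{with } |R|\le C\,b^{1/2}.$$ In particular the expansion $\mathrm{Var}(\hat f_{n,b}(s))=n^{-1}b^{-d/2}(f(s)+\mathcal O(b^{1/2}))/\sqrt{(4\pi)^d\prod_{i=1}^{d+1}s_i}$ holds as $n\to\infty$ along every bandwidth sequence $b=b_n\to0$, $b_n>0$. -/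

import Mathlib

open MeasureTheory ProbabilityTheory
open scoped BigOperators

namespace DirichletKernel

/-- The `ℓ¹` norm of a vector of `ℝ^d`. -/
def l1Norm {d : ℕ} (v : Fin d → ℝ) : ℝ := ∑ i, |v i|

/-- The `d`-dimensional simplex `{v ∈ [0,1]^d : ‖v‖₁ ≤ 1}`. -/
def simplex (d : ℕ) : Set (Fin d → ℝ) :=
  {v | (∀ i, v i ∈ Set.Icc (0 : ℝ) 1) ∧ l1Norm v ≤ 1}

/-- The `Dirichlet(N α, N β)` density on the simplex, extended by zero to `ℝ^d`. -/
noncomputable def dirichletDensity {d : ℕ} (N : ℝ) (α : Fin d → ℝ) (β : ℝ) :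
    (Fin d → ℝ) → ℝ :=
  (simplex d).indicator fun x =>
    Real.Gamma (N * l1Norm α + N * β) / (Real.Gamma (N * β) * ∏ i, Real.Gamma (N * α i)) *
      ((1 - l1Norm x) ^ (N * β - 1) * ∏ i, x i ^ (N * α i - 1))

/-- The Dirichlet kernel estimator with bandwidth `b` at the point `s`, computed from the first
`n` terms of the sequence of observations `X`. -/
noncomputable def kernelEstimator {Ω : Type*} {d : ℕ} (X : ℕ → Ω → Fin d → ℝ) (n : ℕ) (b : ℝ)
    (s : Fin d → ℝ) : Ω → ℝ :=
  fun ω => (1 / (n : ℝ)) * ∑ i ∈ Finset.range n,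
    dirichletDensity (1 / b) (fun j => s j + b) (1 - l1Norm s + b) (X i ω)

/-- The measure on `ℝ^d`, carried by the simplex, with Lebesgue density `f` there. -/
noncomputable def lawOfDensity {d : ℕ} (f : (Fin d → ℝ) → ℝ) : Measure (Fin d → ℝ) :=
  (volume.restrict (simplex d)).withDensity fun x => ENNReal.ofReal (f x)

/-- `f` is Lipschitz on the simplex with constant `L` for the `ℓ¹` norm. -/
def LipschitzOnSimplex {d : ℕ} (L : ℝ) (f : (Fin d → ℝ) → ℝ) : Prop :=
  ∀ x ∈ simplex d, ∀ y ∈ simplex d, |f x - f y| ≤ L * l1Norm (x - y)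

end DirichletKernel

/-!
Since the observations are independent with a common law, the variance of the estimator is
`n⁻¹ (E K² - (E K)²)`, where `K` is the Dirichlet kernel with bandwidth `b`. A probability density
on the simplex with Lipschitz constant `L` is bounded in terms of `d` and `L` alone (`density_le`), so
`(E K)²` is bounded and, after multiplication by `b ^ (d / 2)`, contributes `O(√b)`.

The square of the kernel is a multiple of the `Dirichlet(2 s / b + 1)` density
(`dirichletWeight_sq`). The multiple, `kernelSqMass`, is a product of ratios
`Γ(2 x + 1) / Γ(x + 1) ^ 2`. Stirling's formula is not needed for these: Legendre's duplication
formula reduces each of them to `√x Γ(x + 1/2) / Γ(x + 1)`, which log-convexity of `Γ` puts between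
`1 - 1 / (2 x)` and `1`. This gives `(1 + O(b)) b ^ (-d / 2) / √((4π) ^ d ∏ s_i)` for the multiple
(`kernelSqMass_asymptotic`).

The `Dirichlet(2 s / b + 1)` distribution has mean `s + O(b)` and variances `O(b)`, so that the
Lipschitz function `f` has mean `f s + O(√b)` under it (`integral_abs_sub_mul_le`,
`abs_integral_sub_le`). The moments come from the Dirichlet integral (`integral_dirichletWeight`),
which is proved by integrating `exp (-t)` times the integral over the simplex of size `t` in two
ways, by homogeneity and by Tonelli's theorem.
-/

open Filter Asymptotics Topology

namespace DirichletKernel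

/-! ### Ratios of Gamma functions -/

/-- The ratio `√x Γ(x + 1/2) / Γ(x + 1)`, which tends to `1` at infinity. -/
noncomputable def gammaHalfRatio (x : ℝ) : ℝ :=
  Real.sqrt x * Real.Gamma (x + 1 / 2) / Real.Gamma (x + 1)

/-- Midpoint log-convexity of the Gamma function. -/
lemma Gamma_add_half_sq_le {x : ℝ} (hx : 0 < x) :
    Real.Gamma (x + 1 / 2) ^ 2 ≤ Real.Gamma x * Real.Gamma (x + 1) := by
  have h := Real.Gamma_mul_add_mul_le_rpow_Gamma_mul_rpow_Gamma (s := x) (t := x + 1)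
    (a := 1 / 2) (b := 1 / 2) hx (by linarith) (by norm_num) (by norm_num) (by norm_num)
  rw [show 1 / 2 * x + 1 / 2 * (x + 1) = x + 1 / 2 by ring, ← Real.sqrt_eq_rpow,
    ← Real.sqrt_eq_rpow, ← Real.sqrt_mul (Real.Gamma_pos_of_pos hx).le] at h
  have h0 := Real.Gamma_pos_of_pos (show 0 < x + 1 / 2 by linarith)
  have h1 := Real.Gamma_pos_of_pos hx
  have h2 := Real.Gamma_pos_of_pos (show 0 < x + 1 by linarith)
  calc _ ≤ Real.sqrt (Real.Gamma x * Real.Gamma (x + 1)) ^ 2 := by gcongr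
    _ = _ := Real.sq_sqrt (by positivity)

lemma gammaHalfRatio_pos {x : ℝ} (hx : 0 < x) : 0 < gammaHalfRatio x := by
  have h0 := Real.Gamma_pos_of_pos (show 0 < x + 1 / 2 by linarith)
  have h2 := Real.Gamma_pos_of_pos (show 0 < x + 1 by linarith)
  unfold gammaHalfRatio
  positivity

lemma gammaHalfRatio_sq {x : ℝ} (hx : 0 < x) :
    gammaHalfRatio x ^ 2 = x * Real.Gamma (x + 1 / 2) ^ 2 / Real.Gamma (x + 1) ^ 2 := by
  rw [gammaHalfRatio, div_pow, mul_pow, Real.sq_sqrt hx.le]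

lemma gammaHalfRatio_le_one {x : ℝ} (hx : 0 < x) : gammaHalfRatio x ≤ 1 := by
  have h1 := Real.Gamma_pos_of_pos (show 0 < x + 1 by linarith)
  have h := Gamma_add_half_sq_le hx
  have : gammaHalfRatio x ^ 2 ≤ 1 := by
    rw [gammaHalfRatio_sq hx, div_le_one (by positivity)]
    calc _ ≤ x * (Real.Gamma x * Real.Gamma (x + 1)) := by gcongr
      _ = _ := by rw [Real.Gamma_add_one hx.ne']; ring
  nlinarith [gammaHalfRatio_pos hx]

lemma one_sub_le_gammaHalfRatio {x : ℝ} (hx : 0 < x) : 1 - 1 / (2 * x) ≤ gammaHalfRatio x := by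
  have h1 := Real.Gamma_pos_of_pos (show 0 < x + 1 by linarith)
  have h := Gamma_add_half_sq_le (show 0 < x + 1 / 2 by linarith)
  rw [show x + 1 / 2 + 1 / 2 = x + 1 by ring,
    Real.Gamma_add_one (show x + 1 / 2 ≠ 0 by positivity)] at h
  have h2 : x / (x + 1 / 2) ≤ gammaHalfRatio x ^ 2 := by
    rw [gammaHalfRatio_sq hx, div_le_div_iff₀ (by positivity) (by positivity)]
    nlinarith
  have h3 : 1 - 1 / (2 * x) ≤ x / (x + 1 / 2) := by
    rw [one_sub_div (by positivity), div_le_div_iff₀ (by positivity) (by positivity)]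
    nlinarith
  -- a number in `[0, 1]` dominates its square
  nlinarith [gammaHalfRatio_pos hx, gammaHalfRatio_le_one hx]

lemma abs_gammaHalfRatio_sub_one_le {x : ℝ} (hx : 0 < x) :
    |gammaHalfRatio x - 1| ≤ 1 / (2 * x) := by
  rw [abs_le]
  constructor
  · linarith [one_sub_le_gammaHalfRatio hx]
  · have := gammaHalfRatio_le_one hx
    have : 0 < 1 / (2 * x) := by positivity
    linarith

/-- The central binomial ratio, from Legendre's duplication formula. -/
lemma Gamma_two_mul_add_one_div {x : ℝ} (hx : 0 < x) :
    Real.Gamma (2 * x + 1) / Real.Gamma (x + 1) ^ 2 =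
      4 ^ x * gammaHalfRatio x / (Real.sqrt Real.pi * Real.sqrt x) := by
  have h1 := Real.Gamma_pos_of_pos hx
  have h2 := Real.Gamma_mul_Gamma_add_half x
  rw [Real.rpow_sub (by norm_num), Real.rpow_mul (by norm_num)] at h2
  norm_num at h2
  have h4 : (0 : ℝ) < 4 ^ x := by positivity
  have h5 : Real.Gamma (2 * x) = Real.Gamma x * Real.Gamma (x + 1 / 2) * 4 ^ x /
      (2 * Real.sqrt Real.pi) := by
    rw [h2]
    field_simp
  rw [Real.Gamma_add_one (by positivity), Real.Gamma_add_one hx.ne', h5, gammaHalfRatio,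
    Real.Gamma_add_one hx.ne']
  field_simp

lemma Gamma_add_natCast_add_one {x : ℝ} (hx : 0 < x) (d : ℕ) :
    Real.Gamma (x + d + 1) = (∏ k ∈ Finset.range d, (x + k + 1)) * Real.Gamma (x + 1) := by
  induction d with
  | zero => simp
  | succ d ih =>
    rw [Finset.prod_range_succ, Real.Gamma_add_one (by positivity), Nat.cast_succ,
      ← add_assoc x (d : ℝ) 1, ih]
    ring

/-! ### Functions of the form `1 + O(b)` -/

lemma mul_sub_one_isBigO {u v : ℝ → ℝ} {l : Filter ℝ} (hl : l ≤ 𝓝 0)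
    (hu : (fun b => u b - 1) =O[l] (id : ℝ → ℝ)) (hv : (fun b => v b - 1) =O[l] (id : ℝ → ℝ)) :
    (fun b => u b * v b - 1) =O[l] (id : ℝ → ℝ) := by
  have hid : (id : ℝ → ℝ) =O[l] (fun _ => (1 : ℝ)) :=
    (continuous_id.tendsto (0 : ℝ) |>.mono_left hl).isBigO_one ℝ
  have hv1 : v =O[l] (fun _ => (1 : ℝ)) := by
    simpa using (hv.trans hid).add (isBigO_refl (fun _ => (1 : ℝ)) l)
  have h := hu.mul hv1
  simp only [id, mul_one] at h
  exact (h.add hv).congr_left fun b => by ring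

lemma prod_sub_one_isBigO {ι : Type*} (t : Finset ι) {u : ι → ℝ → ℝ} {l : Filter ℝ} (hl : l ≤ 𝓝 0)
    (hu : ∀ i ∈ t, (fun b => u i b - 1) =O[l] (id : ℝ → ℝ)) :
    (fun b => ∏ i ∈ t, u i b - 1) =O[l] (id : ℝ → ℝ) := by
  classical
  induction t using Finset.induction_on with
  | empty => simpa using isBigO_zero _ _
  | insert a t ha ih =>
    simp only [Finset.prod_insert ha]
    exact mul_sub_one_isBigO hl (hu a (by simp)) (ih fun i hi => hu i (by simp [hi]))

lemma inv_sub_one_isBigO {u : ℝ → ℝ} {l : Filter ℝ} (hl : l ≤ 𝓝 0)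
    (hu : (fun b => u b - 1) =O[l] (id : ℝ → ℝ)) :
    (fun b => (u b)⁻¹ - 1) =O[l] (id : ℝ → ℝ) := by
  have h0 : Tendsto (fun b => u b - 1) l (𝓝 0) :=
    hu.trans_tendsto (continuous_id.tendsto (0 : ℝ) |>.mono_left hl)
  have h1 : Tendsto u l (𝓝 1) := by simpa using h0.add_const 1
  have h2 : (fun b => (u b)⁻¹) =O[l] (fun _ => (1 : ℝ)) :=
    (h1.inv₀ one_ne_zero).isBigO_one ℝ
  have h3 := (hu.mul h2).neg_left
  simp only [mul_one] at h3
  refine h3.congr' ?_ EventuallyEq.rfl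
  filter_upwards [h1.eventually_ne one_ne_zero] with b hb
  field_simp
  ring

lemma gammaHalfRatio_div_sub_one_isBigO {c : ℝ} (hc : 0 < c) :
    (fun b => gammaHalfRatio (c / b) - 1) =O[𝓝[>] 0] (id : ℝ → ℝ) := by
  refine IsBigO.of_bound (1 / (2 * c)) ?_
  filter_upwards [self_mem_nhdsWithin] with b hb
  have hb : 0 < b := hb
  refine (abs_gammaHalfRatio_sub_one_le (div_pos hc hb)).trans_eq ?_
  rw [id, Real.norm_eq_abs, abs_of_pos hb]
  field_simp

/-- The integral `∫ K²` of the squared Dirichlet kernel with bandwidth `b`, in closed form; `r`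
stands for the last barycentric coordinate. -/
noncomputable def kernelSqMass {d : ℕ} (s : Fin d → ℝ) (r b : ℝ) : ℝ :=
  Real.Gamma (1 / b + d + 1) ^ 2 / Real.Gamma (2 * (1 / b) + d + 1) *
    ((∏ i, Real.Gamma (2 * (s i / b) + 1) / Real.Gamma (s i / b + 1) ^ 2) *
      (Real.Gamma (2 * (r / b) + 1) / Real.Gamma (r / b + 1) ^ 2))

/-- The constant `√((4π)^d (∏ s_i) r)` of the variance expansion, where `r` stands for the last
barycentric coordinate. -/
noncomputable def varianceConst {d : ℕ} (s : Fin d → ℝ) (r : ℝ) : ℝ :=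
  Real.sqrt ((4 * Real.pi) ^ d * ((∏ i, s i) * r))

/-- The powers of `4` cancel because the barycentric coordinates sum to `1`. -/
lemma kernelSqMass_mul_eq {d : ℕ} {s : Fin d → ℝ} {r b : ℝ} (hs : ∀ i, 0 < s i) (hr : 0 < r)
    (hsum : ∑ i, s i + r = 1) (hb : 0 < b) :
    kernelSqMass s r b * (b ^ ((d : ℝ) / 2) * varianceConst s r) =
      (∏ k ∈ Finset.range d, (1 + (k + 1) * b) * ((1 + (k + 1) * b) * (1 + (k + 1) / 2 * b)⁻¹)) *
        ((∏ i, gammaHalfRatio (s i / b)) * gammaHalfRatio (r / b) * (gammaHalfRatio (1 / b))⁻¹) := by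
  have hN : 0 < 1 / b := by positivity
  have e1 : Real.Gamma (1 / b + d + 1) ^ 2 / Real.Gamma (2 * (1 / b) + d + 1) =
      (∏ k ∈ Finset.range d, (1 + (k + 1) * b) * ((1 + (k + 1) * b) * (1 + (k + 1) / 2 * b)⁻¹)) *
      (1 / (2 * b)) ^ d * (Real.sqrt Real.pi * Real.sqrt (1 / b) / (4 ^ (1 / b) *
        gammaHalfRatio (1 / b))) := by
    have h := Gamma_two_mul_add_one_div hN
    have hg := Real.Gamma_pos_of_pos (show 0 < 1 / b + 1 by positivity)
    have hg2 := Real.Gamma_pos_of_pos (show 0 < 2 * (1 / b) + 1 by positivity)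
    rw [Gamma_add_natCast_add_one hN, Gamma_add_natCast_add_one (show 0 < 2 * (1 / b) by positivity)]
    have h' : Real.Gamma (1 / b + 1) ^ 2 / Real.Gamma (2 * (1 / b) + 1) =
        Real.sqrt Real.pi * Real.sqrt (1 / b) / (4 ^ (1 / b) * gammaHalfRatio (1 / b)) := by
      rw [← inv_inj, inv_div, h, inv_div]
    rw [← h', mul_pow, mul_div_mul_comm]
    congr 1
    rw [← Finset.prod_pow, ← Finset.prod_div_distrib]
    rw [show (1 / (2 * b)) ^ d = ∏ k ∈ Finset.range d, (1 / (2 * b)) by simp,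
      ← Finset.prod_mul_distrib]
    refine Finset.prod_congr rfl fun k _ => ?_
    have : 0 < 1 + ((k : ℝ) + 1) / 2 * b := by positivity
    have : 0 < 2 * (1 / b) + (k : ℝ) + 1 := by positivity
    field_simp
    ring

  rw [kernelSqMass, e1, Gamma_two_mul_add_one_div (div_pos hr hb)]
  have e2 : ∏ i, Real.Gamma (2 * (s i / b) + 1) / Real.Gamma (s i / b + 1) ^ 2 =
      4 ^ (∑ i, s i / b) * (∏ i, gammaHalfRatio (s i / b)) /
        (Real.sqrt Real.pi ^ d * ∏ i, Real.sqrt (s i / b)) := by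
    simp_rw [fun i => Gamma_two_mul_add_one_div (div_pos (hs i) hb)]
    rw [Finset.prod_div_distrib, Finset.prod_mul_distrib, Finset.prod_mul_distrib,
      Real.rpow_sum_of_pos (by norm_num : (0 : ℝ) < 4)]
    simp
  rw [e2]
  have e4 : (4 : ℝ) ^ (1 / b) = 4 ^ (∑ i, s i / b) * 4 ^ (r / b) := by
    rw [← Real.rpow_add (by norm_num), ← Finset.sum_div, ← add_div, hsum]
  have hps : 0 < ∏ i, s i := Finset.prod_pos fun i _ => hs i
  have hprs : ∏ i, Real.sqrt (s i / b) = Real.sqrt (∏ i, s i) / Real.sqrt b ^ d := by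
    rw [Real.sqrt_eq_rpow, ← Real.finsetProd_rpow _ _ (fun i _ => (hs i).le)]
    simp_rw [Real.sqrt_div (hs _).le, Real.sqrt_eq_rpow]
    rw [Finset.prod_div_distrib]; simp
  have hbd : b ^ ((d : ℝ) / 2) = Real.sqrt b ^ d := by
    rw [Real.sqrt_eq_rpow, ← Real.rpow_natCast, ← Real.rpow_mul hb.le]
    congr 1; ring
  have hvc : varianceConst s r = 2 ^ d * Real.sqrt Real.pi ^ d *
      (Real.sqrt (∏ i, s i) * Real.sqrt r) := by
    rw [varianceConst, Real.sqrt_mul (by positivity), Real.sqrt_mul hps.le]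
    congr 1
    rw [show (4 * Real.pi) ^ d = (2 ^ d * Real.sqrt Real.pi ^ d) ^ 2 by
      rw [← mul_pow, ← pow_mul, mul_comm d 2, pow_mul, mul_pow 2, Real.sq_sqrt Real.pi_pos.le]
      norm_num, Real.sqrt_sq (by positivity)]
  have hG := gammaHalfRatio_pos hN
  have hsb : Real.sqrt b ^ 2 = b := Real.sq_sqrt hb.le
  have hsbp : 0 < Real.sqrt b := Real.sqrt_pos.2 hb
  have hrp : 0 < Real.sqrt r := Real.sqrt_pos.2 hr
  have hpp : 0 < Real.sqrt (∏ i, s i) := Real.sqrt_pos.2 hps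
  have hpi : 0 < Real.sqrt Real.pi := Real.sqrt_pos.2 Real.pi_pos
  rw [e4, hprs, hbd, hvc, Real.sqrt_div zero_le_one, Real.sqrt_div hr.le, Real.sqrt_one]
  have hb2 : (1 / (2 * b)) ^ d = 1 / (2 ^ d * (Real.sqrt b ^ d * Real.sqrt b ^ d)) := by
    rw [div_pow, one_pow, mul_pow, ← mul_pow (Real.sqrt b), ← sq (Real.sqrt b), hsb]
  rw [hb2]
  generalize (∏ k ∈ Finset.range d, (1 + ((k : ℝ) + 1) * b) *
    ((1 + (k + 1) * b) * (1 + (k + 1) / 2 * b)⁻¹)) = H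
  generalize (∏ i, gammaHalfRatio (s i / b)) = Q
  have h41 : (0 : ℝ) < 4 ^ (∑ i, s i / b) := by positivity
  have h42 : (0 : ℝ) < 4 ^ (r / b) := by positivity
  field_simp

lemma one_add_mul_sub_one_isBigO (c : ℝ) (l : Filter ℝ) :
    (fun b => (1 + c * b) - 1) =O[l] (id : ℝ → ℝ) := by
  simpa using (isBigO_refl (id : ℝ → ℝ) l).const_mul_left c

/-- First-order asymptotics of `∫ K²`, with error `O(b)`. -/
lemma kernelSqMass_asymptotic {d : ℕ} {s : Fin d → ℝ} {r : ℝ} (hs : ∀ i, 0 < s i) (hr : 0 < r)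
    (hsum : ∑ i, s i + r = 1) :
    ∃ c > 0, ∃ b₀ > 0, ∀ b, 0 < b → b < b₀ →
      |kernelSqMass s r b * (b ^ ((d : ℝ) / 2) * varianceConst s r) - 1| ≤ c * b := by
  have hl : 𝓝[>] (0 : ℝ) ≤ 𝓝 0 := nhdsWithin_le_nhds
  have h : (fun b : ℝ => (∏ k ∈ Finset.range d,
      (1 + ((k : ℝ) + 1) * b) * ((1 + (k + 1) * b) * (1 + (k + 1) / 2 * b)⁻¹)) *
        ((∏ i, gammaHalfRatio (s i / b)) * gammaHalfRatio (r / b) *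
          (gammaHalfRatio (1 / b))⁻¹) - 1) =O[𝓝[>] 0] (id : ℝ → ℝ) := by
    refine mul_sub_one_isBigO hl (prod_sub_one_isBigO _ hl fun k _ => ?_)
      (mul_sub_one_isBigO hl (mul_sub_one_isBigO hl (prod_sub_one_isBigO _ hl fun i _ => ?_) ?_) ?_)
    · exact mul_sub_one_isBigO hl (one_add_mul_sub_one_isBigO _ _)
        (mul_sub_one_isBigO hl (one_add_mul_sub_one_isBigO _ _)
          (inv_sub_one_isBigO hl (one_add_mul_sub_one_isBigO _ _)))
    · exact gammaHalfRatio_div_sub_one_isBigO (hs i)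
    · exact gammaHalfRatio_div_sub_one_isBigO hr
    · exact inv_sub_one_isBigO hl (gammaHalfRatio_div_sub_one_isBigO one_pos)
  obtain ⟨c, hc, hcb⟩ := h.exists_pos
  rw [IsBigOWith, eventually_nhdsWithin_iff, Metric.eventually_nhds_iff] at hcb
  obtain ⟨ε, hε, hcb⟩ := hcb
  refine ⟨c, hc, ε, hε, fun b hb hbε => ?_⟩
  have := hcb (y := b) (by simpa [abs_of_pos hb] using hbε) hb
  rw [kernelSqMass_mul_eq hs hr hsum hb]
  simpa [abs_of_pos hb] using this

/-! ### The Dirichlet integral -/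

/-- The truncated power `y ^ (a - 1)` on `[0, ∞)`, extended by zero. -/
noncomputable def truncPow (a : ℝ) : ℝ → ℝ :=
  (Set.Ici (0 : ℝ)).indicator fun y => y ^ (a - 1)

lemma truncPow_nonneg (a y : ℝ) : 0 ≤ truncPow a y :=
  Set.indicator_nonneg (fun _ hy => Real.rpow_nonneg hy _) y

lemma truncPow_of_nonneg (a : ℝ) {y : ℝ} (hy : 0 ≤ y) : truncPow a y = y ^ (a - 1) :=
  Set.indicator_of_mem (s := Set.Ici 0) hy _

lemma truncPow_of_neg (a : ℝ) {y : ℝ} (hy : y < 0) : truncPow a y = 0 :=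
  Set.indicator_of_notMem (s := Set.Ici 0) (by simpa using hy) _

@[fun_prop]
lemma measurable_truncPow (a : ℝ) : Measurable (truncPow a) :=
  Measurable.indicator (by fun_prop) measurableSet_Ici

lemma truncPow_mul (a : ℝ) {t : ℝ} (ht : 0 < t) (y : ℝ) :
    truncPow a (t * y) = t ^ (a - 1) * truncPow a y := by
  rcases lt_or_ge y 0 with hy | hy
  · rw [truncPow_of_neg _ hy, truncPow_of_neg _ (mul_neg_of_pos_of_neg ht hy), mul_zero]
  · rw [truncPow_of_nonneg _ hy, truncPow_of_nonneg _ (by positivity), Real.mul_rpow ht.le hy]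

lemma exp_mul_truncPow_eq_indicator (a : ℝ) :
    (fun y => Real.exp (-y) * truncPow a y) =
      (Set.Ici (0 : ℝ)).indicator fun y => Real.exp (-y) * y ^ (a - 1) := by
  ext y
  by_cases hy : y ∈ Set.Ici (0 : ℝ) <;> simp [truncPow, hy]

lemma integrable_exp_mul_truncPow {a : ℝ} (ha : 0 < a) :
    Integrable fun y => Real.exp (-y) * truncPow a y := by
  rw [exp_mul_truncPow_eq_indicator, integrable_indicator_iff measurableSet_Ici,
    integrableOn_Ici_iff_integrableOn_Ioi]
  exact Real.GammaIntegral_convergent ha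

lemma integral_exp_mul_truncPow {a : ℝ} (ha : 0 < a) :
    ∫ y, Real.exp (-y) * truncPow a y = Real.Gamma a := by
  rw [exp_mul_truncPow_eq_indicator, integral_indicator measurableSet_Ici,
    integral_Ici_eq_integral_Ioi, Real.Gamma_eq_integral ha]

lemma lintegral_exp_mul_truncPow {a : ℝ} (ha : 0 < a) :
    ∫⁻ y, ENNReal.ofReal (Real.exp (-y) * truncPow a y) = ENNReal.ofReal (Real.Gamma a) := by
  rw [← integral_exp_mul_truncPow ha, ofReal_integral_eq_lintegral_ofReal
    (integrable_exp_mul_truncPow ha)]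
  exact ae_of_all _ fun y => mul_nonneg (Real.exp_pos _).le (truncPow_nonneg _ _)

variable {d : ℕ}

/-- The unnormalised Dirichlet density on the simplex of size `t`, extended by zero. -/
noncomputable def dirichletWeight (α : Fin d → ℝ) (β : ℝ) (t : ℝ) (x : Fin d → ℝ) : ℝ :=
  truncPow β (t - ∑ i, x i) * ∏ i, truncPow (α i) (x i)

lemma dirichletWeight_nonneg (α : Fin d → ℝ) (β : ℝ) (t : ℝ) (x : Fin d → ℝ) :
    0 ≤ dirichletWeight α β t x :=
  mul_nonneg (truncPow_nonneg _ _) (Finset.prod_nonneg fun _ _ => truncPow_nonneg _ _)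

lemma measurable_dirichletWeight_uncurry (α : Fin d → ℝ) (β : ℝ) :
    Measurable fun p : ℝ × (Fin d → ℝ) => dirichletWeight α β p.1 p.2 := by
  unfold dirichletWeight
  fun_prop

@[fun_prop]
lemma measurable_dirichletWeight (α : Fin d → ℝ) (β t : ℝ) :
    Measurable (dirichletWeight α β t) := by
  unfold dirichletWeight
  fun_prop

lemma dirichletWeight_of_neg (α : Fin d → ℝ) (β : ℝ) {t : ℝ} (ht : t < 0) (x : Fin d → ℝ) :
    dirichletWeight α β t x = 0 := by
  rw [dirichletWeight]
  by_cases h : ∀ i, 0 ≤ x i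
  · have := Finset.sum_nonneg fun i (_ : i ∈ Finset.univ) => h i
    rw [truncPow_of_neg _ (by linarith), zero_mul]
  · push Not at h
    obtain ⟨i, hi⟩ := h
    rw [Finset.prod_eq_zero (Finset.mem_univ i) (truncPow_of_neg _ hi), mul_zero]

lemma dirichletWeight_smul (α : Fin d → ℝ) (β : ℝ) {t : ℝ} (ht : 0 < t) (x : Fin d → ℝ) :
    dirichletWeight α β t (t • x) =
      t ^ (∑ i, α i + β - 1 - d) * dirichletWeight α β 1 x := by
  have h1 : t - ∑ i, (t • x) i = t * (1 - ∑ i, x i) := by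
    simp [mul_sub, Finset.mul_sum]
  rw [dirichletWeight, h1, truncPow_mul _ ht]
  simp only [Pi.smul_apply, smul_eq_mul, truncPow_mul _ ht]
  rw [Finset.prod_mul_distrib, ← Real.rpow_sum_of_pos ht, dirichletWeight,
    show ∑ i, α i + β - 1 - d = (β - 1) + ∑ i, (α i - 1) by simp; ring, Real.rpow_add ht]
  ring

lemma lintegral_dirichletWeight_scaling (α : Fin d → ℝ) (β : ℝ) {t : ℝ} (ht : 0 < t) :
    ∫⁻ x, ENNReal.ofReal (dirichletWeight α β t x) =
      ENNReal.ofReal (t ^ (∑ i, α i + β - 1)) *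
        ∫⁻ x, ENNReal.ofReal (dirichletWeight α β 1 x) := by
  have hm : Measurable fun x : Fin d → ℝ => ENNReal.ofReal (dirichletWeight α β t x) := by
    fun_prop
  have h := Measure.map_addHaar_smul (volume : Measure (Fin d → ℝ)) ht.ne'
  have h2 : ∫⁻ x, ENNReal.ofReal (dirichletWeight α β t (t • x)) =
      ENNReal.ofReal |(t ^ d)⁻¹| * ∫⁻ x, ENNReal.ofReal (dirichletWeight α β t x) := by
    rw [← lintegral_map hm (by fun_prop : Measurable fun x : Fin d → ℝ => t • x), h]
    simp
  simp_rw [dirichletWeight_smul α β ht, ENNReal.ofReal_mul (Real.rpow_nonneg ht.le _)] at h2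
  rw [lintegral_const_mul _ (by fun_prop)] at h2
  have h3 : (1 : ENNReal) = ENNReal.ofReal (t ^ d) * ENNReal.ofReal |(t ^ d)⁻¹| := by
    rw [← ENNReal.ofReal_mul (by positivity), abs_of_pos (by positivity),
      mul_inv_cancel₀ (by positivity), ENNReal.ofReal_one]
  rw [← one_mul (∫⁻ x, ENNReal.ofReal (dirichletWeight α β t x)), h3, mul_assoc, ← h2,
    ← mul_assoc, ← ENNReal.ofReal_mul (by positivity), ← Real.rpow_natCast, ← Real.rpow_add ht]
  congr 3
  ring

/-- The Dirichlet integral. With `I t` the integral over the simplex of size `t`, the integral of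
`exp (-t) * I t` over `t` is computed by homogeneity of `I`, and by Tonelli's theorem as a product
of Gamma integrals. -/
lemma lintegral_dirichletWeight {α : Fin d → ℝ} {β : ℝ} (hα : ∀ i, 0 < α i) (hβ : 0 < β) :
    ∫⁻ x, ENNReal.ofReal (dirichletWeight α β 1 x) =
      ENNReal.ofReal ((∏ i, Real.Gamma (α i)) * Real.Gamma β / Real.Gamma (∑ i, α i + β)) := by
  have hA : 0 < ∑ i, α i + β := by
    have := Finset.sum_nonneg fun i (_ : i ∈ Finset.univ) => (hα i).le
    linarith
  have hG := Real.Gamma_pos_of_pos hA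
  have hGp : 0 ≤ ∏ i, Real.Gamma (α i) :=
    Finset.prod_nonneg fun i _ => (Real.Gamma_pos_of_pos (hα i)).le
  have key1 : ∫⁻ t : ℝ, ∫⁻ x, ENNReal.ofReal (Real.exp (-t) * dirichletWeight α β t x) =
      ENNReal.ofReal (Real.Gamma (∑ i, α i + β)) *
        ∫⁻ x, ENNReal.ofReal (dirichletWeight α β 1 x) := by
    rw [← lintegral_exp_mul_truncPow hA, ← lintegral_mul_const _ (by fun_prop)]
    refine lintegral_congr_ae ?_
    filter_upwards [compl_mem_ae_iff.2 (measure_singleton (μ := (volume : Measure ℝ)) 0)] with t ht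
    rcases lt_or_gt_of_ne ht with h | h
    · simp [dirichletWeight_of_neg α β h, truncPow_of_neg _ h]
    · simp_rw [ENNReal.ofReal_mul (Real.exp_pos (-t)).le]
      rw [lintegral_const_mul _ (by fun_prop), lintegral_dirichletWeight_scaling α β h,
        truncPow_of_nonneg _ h.le, mul_assoc]
  have key2 : ∫⁻ x : Fin d → ℝ, ∫⁻ t : ℝ,
      ENNReal.ofReal (Real.exp (-t) * dirichletWeight α β t x) =
      ENNReal.ofReal ((∏ i, Real.Gamma (α i)) * Real.Gamma β) := by
    have inner : ∀ x : Fin d → ℝ, ∫⁻ t : ℝ,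
        ENNReal.ofReal (Real.exp (-t) * dirichletWeight α β t x) =
        ENNReal.ofReal (∏ i, Real.exp (-x i) * truncPow (α i) (x i)) *
          ENNReal.ofReal (Real.Gamma β) := by
      intro x
      have hp : 0 ≤ ∏ i, Real.exp (-x i) * truncPow (α i) (x i) :=
        Finset.prod_nonneg fun i _ => mul_nonneg (Real.exp_pos _).le (truncPow_nonneg _ _)
      rw [← lintegral_exp_mul_truncPow hβ, ← lintegral_const_mul _ (by fun_prop),
        ← lintegral_sub_right_eq_self (fun t => ENNReal.ofReal
          (∏ i, Real.exp (-x i) * truncPow (α i) (x i)) *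
            ENNReal.ofReal (Real.exp (-t) * truncPow β t)) (∑ i, x i)]
      refine lintegral_congr fun t => ?_
      rw [← ENNReal.ofReal_mul hp, Finset.prod_mul_distrib, ← Real.exp_sum, dirichletWeight,
        Finset.sum_neg_distrib, show -(t - ∑ i, x i) = -t + ∑ i, x i by ring, Real.exp_add]
      congr 1
      rw [Real.exp_neg (∑ i, x i)]
      have := Real.exp_pos (∑ i, x i)
      field_simp
    simp_rw [inner]
    have hint : Integrable fun x : Fin d → ℝ => ∏ i, Real.exp (-x i) * truncPow (α i) (x i) :=
      Integrable.fintype_prod (f := fun i y => Real.exp (-y) * truncPow (α i) y)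
        fun i => integrable_exp_mul_truncPow (hα i)
    rw [lintegral_mul_const _ (by fun_prop), ← ofReal_integral_eq_lintegral_ofReal hint
      (ae_of_all _ fun x => Finset.prod_nonneg fun i _ =>
        mul_nonneg (Real.exp_pos _).le (truncPow_nonneg _ _))]
    rw [integral_fintype_prod_volume_eq_prod (fun i y => Real.exp (-y) * truncPow (α i) y)]
    simp_rw [integral_exp_mul_truncPow (hα _)]
    rw [← ENNReal.ofReal_mul hGp]
  rw [lintegral_lintegral_swap] at key1
  · rw [key2] at key1
    rw [ENNReal.ofReal_div_of_pos hG, key1, mul_comm, ENNReal.mul_div_cancel_right]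
    · simpa using hG
    · simp
  · have := measurable_dirichletWeight_uncurry α β
    refine Measurable.aemeasurable ?_
    unfold Function.uncurry
    fun_prop

lemma integrable_dirichletWeight {α : Fin d → ℝ} {β : ℝ} (hα : ∀ i, 0 < α i) (hβ : 0 < β) :
    Integrable (dirichletWeight α β 1) := by
  refine ⟨by fun_prop, ?_⟩
  rw [hasFiniteIntegral_iff_ofReal (ae_of_all _ (dirichletWeight_nonneg α β 1)),
    lintegral_dirichletWeight hα hβ]
  exact ENNReal.ofReal_lt_top

lemma integral_dirichletWeight {α : Fin d → ℝ} {β : ℝ} (hα : ∀ i, 0 < α i) (hβ : 0 < β) :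
    ∫ x, dirichletWeight α β 1 x =
      (∏ i, Real.Gamma (α i)) * Real.Gamma β / Real.Gamma (∑ i, α i + β) := by
  have hA : 0 < ∑ i, α i + β := by
    have := Finset.sum_nonneg fun i (_ : i ∈ Finset.univ) => (hα i).le
    linarith
  have hG := Real.Gamma_pos_of_pos hA
  have hGp : 0 ≤ ∏ i, Real.Gamma (α i) :=
    Finset.prod_nonneg fun i _ => (Real.Gamma_pos_of_pos (hα i)).le
  have hb := Real.Gamma_pos_of_pos hβ
  rw [integral_eq_lintegral_of_nonneg_ae (ae_of_all _ (dirichletWeight_nonneg α β 1))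
    (by fun_prop), lintegral_dirichletWeight hα hβ, ENNReal.toReal_ofReal (by positivity)]

/-! ### Moments of the Dirichlet distribution -/

lemma mul_dirichletWeight {α : Fin d → ℝ} (hα : ∀ i, 0 < α i) (β : ℝ) (j : Fin d)
    (x : Fin d → ℝ) :
    x j * dirichletWeight α β 1 x = dirichletWeight (α + Pi.single j 1) β 1 x := by
  have h : ∀ i, truncPow ((α + (Pi.single j 1 : Fin d → ℝ)) i) (x i) =
      truncPow (α i) (x i) * if i = j then x j else 1 := by
    intro i
    split_ifs with hij
    · subst hij
      rcases lt_or_ge (x i) 0 with hx | hx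
      · simp [truncPow_of_neg _ hx]
      · rw [truncPow_of_nonneg _ hx, truncPow_of_nonneg _ hx, ← Real.rpow_add_one' hx]
        · congr 1; simp
        · simpa using (hα i).ne'
    · simp [hij]
  simp only [dirichletWeight, h, Finset.prod_mul_distrib, Finset.prod_ite_eq', Finset.mem_univ,
    if_true]
  ring

lemma add_single_pos {α : Fin d → ℝ} (hα : ∀ i, 0 < α i) (j : Fin d) :
    ∀ i, 0 < (α + (Pi.single j 1 : Fin d → ℝ)) i := by
  intro i
  have : 0 ≤ (Pi.single j (1 : ℝ) : Fin d → ℝ) i :=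
    (Pi.single_nonneg.2 zero_le_one : (0 : Fin d → ℝ) ≤ Pi.single j 1) i
  exact add_pos_of_pos_of_nonneg (hα i) this

lemma integral_mul_dirichletWeight {α : Fin d → ℝ} {β : ℝ} (hα : ∀ i, 0 < α i) (hβ : 0 < β)
    (j : Fin d) :
    ∫ x, x j * dirichletWeight α β 1 x =
      α j / (∑ i, α i + β) * ∫ x, dirichletWeight α β 1 x := by
  have hA : 0 < ∑ i, α i + β := by
    have := Finset.sum_nonneg fun i (_ : i ∈ Finset.univ) => (hα i).le
    linarith
  have hG := Real.Gamma_pos_of_pos hA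
  simp_rw [mul_dirichletWeight hα]
  rw [integral_dirichletWeight (add_single_pos hα j) hβ, integral_dirichletWeight hα hβ]
  have h : ∀ i, Real.Gamma ((α + (Pi.single j 1 : Fin d → ℝ)) i) =
      Real.Gamma (α i) * if i = j then α j else 1 := by
    intro i
    split_ifs with hij
    · subst hij
      simp [Real.Gamma_add_one (hα i).ne', mul_comm]
    · simp [hij]
  have h2 : ∑ i, (α + (Pi.single j 1 : Fin d → ℝ)) i + β = (∑ i, α i + β) + 1 := by
    simp [Finset.sum_add_distrib]; ring
  rw [h2, Real.Gamma_add_one hA.ne']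
  simp only [h, Finset.prod_mul_distrib, Finset.prod_ite_eq', Finset.mem_univ, if_true]
  field_simp

/-- The second moment about `c` of a coordinate, in terms of the mean `α_j / A` and of the second
moment `α_j (α_j + 1) / (A (A + 1))`, where `A = ∑ α_i + β`. -/
lemma integral_sub_sq_mul_dirichletWeight {α : Fin d → ℝ} {β : ℝ} (hα : ∀ i, 0 < α i)
    (hβ : 0 < β) (j : Fin d) (c : ℝ) :
    Integrable (fun x => (x j - c) ^ 2 * dirichletWeight α β 1 x) ∧
    ∫ x, (x j - c) ^ 2 * dirichletWeight α β 1 x =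
      (α j * (α j + 1) / ((∑ i, α i + β) * (∑ i, α i + β + 1)) -
        2 * c * (α j / (∑ i, α i + β)) + c ^ 2) * ∫ x, dirichletWeight α β 1 x := by
  have hα' := add_single_pos hα j
  have hα'' := add_single_pos hα' j
  have e : ∀ x : Fin d → ℝ, (x j - c) ^ 2 * dirichletWeight α β 1 x =
      dirichletWeight (α + Pi.single j 1 + Pi.single j 1) β 1 x -
        2 * c * dirichletWeight (α + Pi.single j 1) β 1 x + c ^ 2 * dirichletWeight α β 1 x := by
    intro x
    rw [← mul_dirichletWeight hα', ← mul_dirichletWeight hα]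
    ring
  have i0 := integrable_dirichletWeight hα hβ
  have i1 := integrable_dirichletWeight hα' hβ
  have i2 := integrable_dirichletWeight hα'' hβ
  have i3 : Integrable fun x => dirichletWeight (α + Pi.single j 1 + Pi.single j 1) β 1 x -
      2 * c * dirichletWeight (α + Pi.single j 1) β 1 x := i2.sub (i1.const_mul _)
  simp_rw [e]
  refine ⟨i3.add (i0.const_mul _), ?_⟩
  rw [integral_add i3 (i0.const_mul _), integral_sub i2 (i1.const_mul _),
    integral_const_mul, integral_const_mul]
  have m1 := integral_mul_dirichletWeight hα hβ j
  have m2 := integral_mul_dirichletWeight hα' hβ j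
  simp_rw [mul_dirichletWeight hα] at m1
  simp_rw [mul_dirichletWeight hα'] at m2
  have h2 : ∑ i, (α + (Pi.single j 1 : Fin d → ℝ)) i + β = (∑ i, α i + β) + 1 := by
    simp [Finset.sum_add_distrib]; ring
  have h3 : (α + (Pi.single j 1 : Fin d → ℝ)) j = α j + 1 := by simp
  rw [m2, m1, h2, h3]
  have hA : 0 < ∑ i, α i + β := by
    have := Finset.sum_nonneg fun i (_ : i ∈ Finset.univ) => (hα i).le
    linarith
  field_simp

/-! ### Weights on the unit simplex -/

lemma mem_simplex_iff {x : Fin d → ℝ} : x ∈ simplex d ↔ (∀ i, 0 ≤ x i) ∧ ∑ i, x i ≤ 1 := by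
  constructor
  · rintro ⟨h1, h2⟩
    have h3 : ∀ i, 0 ≤ x i := fun i => (h1 i).1
    exact ⟨h3, by simpa [l1Norm, abs_of_nonneg (h3 _)] using h2⟩
  · rintro ⟨h1, h2⟩
    refine ⟨fun i => ⟨h1 i, ?_⟩, by simpa [l1Norm, abs_of_nonneg (h1 _)] using h2⟩
    exact (Finset.single_le_sum (fun i _ => h1 i) (Finset.mem_univ i)).trans h2

lemma l1Norm_of_nonneg {x : Fin d → ℝ} (hx : ∀ i, 0 ≤ x i) : l1Norm x = ∑ i, x i := by
  simp [l1Norm, abs_of_nonneg (hx _)]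

lemma dirichletWeight_of_notMem (α : Fin d → ℝ) (β : ℝ) {x : Fin d → ℝ} (hx : x ∉ simplex d) :
    dirichletWeight α β 1 x = 0 := by
  rw [dirichletWeight]
  by_cases h : ∀ i, 0 ≤ x i
  · rw [mem_simplex_iff, not_and, not_le] at hx
    rw [truncPow_of_neg _ (by linarith [hx h]), zero_mul]
  · push Not at h
    obtain ⟨i, hi⟩ := h
    rw [Finset.prod_eq_zero (Finset.mem_univ i) (truncPow_of_neg _ hi), mul_zero]

lemma dirichletWeight_of_mem (α : Fin d → ℝ) (β : ℝ) {x : Fin d → ℝ} (hx : x ∈ simplex d) :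
    dirichletWeight α β 1 x = (1 - l1Norm x) ^ (β - 1) * ∏ i, x i ^ (α i - 1) := by
  rw [mem_simplex_iff] at hx
  rw [dirichletWeight, l1Norm_of_nonneg hx.1, truncPow_of_nonneg _ (by linarith [hx.2])]
  simp_rw [truncPow_of_nonneg _ (hx.1 _)]

lemma dirichletDensity_eq (N : ℝ) (α : Fin d → ℝ) (β : ℝ) (x : Fin d → ℝ) :
    dirichletDensity N α β x =
      Real.Gamma (N * l1Norm α + N * β) / (Real.Gamma (N * β) * ∏ i, Real.Gamma (N * α i)) *
        dirichletWeight (fun i => N * α i) (N * β) 1 x := by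
  by_cases hx : x ∈ simplex d
  · rw [dirichletDensity, Set.indicator_of_mem hx, dirichletWeight_of_mem _ _ hx]
  · rw [dirichletDensity, Set.indicator_of_notMem hx, dirichletWeight_of_notMem _ _ hx, mul_zero]

lemma dirichletWeight_sq (α : Fin d → ℝ) (β : ℝ) (x : Fin d → ℝ) :
    dirichletWeight α β 1 x ^ 2 =
      dirichletWeight (fun i => 2 * α i - 1) (2 * β - 1) 1 x := by
  by_cases hx : x ∈ simplex d
  · rw [dirichletWeight_of_mem _ _ hx, dirichletWeight_of_mem _ _ hx, mul_pow, ← Finset.prod_pow]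
    rw [mem_simplex_iff] at hx
    have h2 : ∀ {y a : ℝ}, 0 ≤ y → (y ^ (a - 1)) ^ 2 = y ^ (2 * a - 1 - 1) := by
      intro y a hy
      rw [← Real.rpow_natCast, ← Real.rpow_mul hy]
      congr 1; push_cast; ring
    rw [h2 (by rw [l1Norm_of_nonneg hx.1]; linarith [hx.2])]
    simp_rw [h2 (hx.1 _)]
  · rw [dirichletWeight_of_notMem _ _ hx, dirichletWeight_of_notMem _ _ hx]; norm_num

lemma dirichletWeight_le_one {α : Fin d → ℝ} {β : ℝ} (hα : ∀ i, 1 ≤ α i) (hβ : 1 ≤ β)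
    (x : Fin d → ℝ) : dirichletWeight α β 1 x ≤ 1 := by
  by_cases hx : x ∈ simplex d
  · have hx' := mem_simplex_iff.1 hx
    have hs := Finset.sum_nonneg fun i (_ : i ∈ Finset.univ) => hx'.1 i
    rw [dirichletWeight_of_mem _ _ hx, l1Norm_of_nonneg hx'.1]
    refine mul_le_one₀ (Real.rpow_le_one (by linarith [hx'.2]) (by linarith) (by linarith))
      (Finset.prod_nonneg fun i _ => Real.rpow_nonneg (hx'.1 i) _)
      (Finset.prod_le_one (fun i _ => Real.rpow_nonneg (hx'.1 i) _) fun i _ =>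
        Real.rpow_le_one (hx'.1 i) (hx.1 i).2 (by linarith [hα i]))
  · rw [dirichletWeight_of_notMem _ _ hx]; exact zero_le_one

/-! ### Geometry of the simplex -/

lemma isClosed_simplex : IsClosed (simplex d) := by
  have : simplex d = (⋂ i, {v | 0 ≤ v i}) ∩ {v | ∑ i, v i ≤ 1} := by
    ext v; simp [mem_simplex_iff]
  rw [this]
  exact (isClosed_iInter fun i => isClosed_le continuous_const (continuous_apply i)).inter
    (isClosed_le (by fun_prop) continuous_const)

lemma measurableSet_simplex : MeasurableSet (simplex d) := isClosed_simplex.measurableSet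

lemma volume_simplex_lt_top : volume (simplex d) < ⊤ :=
  lt_of_le_of_lt (measure_mono (t := Set.Icc 0 1) fun _ hx =>
    ⟨fun i => (hx.1 i).1, fun i => (hx.1 i).2⟩) isCompact_Icc.measure_lt_top

lemma l1Norm_sub_le_two {x y : Fin d → ℝ} (hx : x ∈ simplex d) (hy : y ∈ simplex d) :
    l1Norm (x - y) ≤ 2 := by
  have : l1Norm (x - y) ≤ l1Norm x + l1Norm y := by
    rw [l1Norm, l1Norm, l1Norm, ← Finset.sum_add_distrib]
    exact Finset.sum_le_sum fun i _ => abs_sub (x i) (y i)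
  linarith [hx.2, hy.2]

lemma pos_of_mem_interior_simplex {s : Fin d → ℝ} (hs : s ∈ interior (simplex d)) (i : Fin d) :
    0 < s i ∧ l1Norm s < 1 := by
  have hc : Continuous fun t : ℝ => s + t • (Pi.single i 1 : Fin d → ℝ) := by fun_prop
  have h0 : ∀ᶠ t in 𝓝 (0 : ℝ), s + t • (Pi.single i 1 : Fin d → ℝ) ∈ simplex d :=
    hc.continuousAt.eventually (by
      simpa using mem_interior_iff_mem_nhds.1 hs)
  obtain ⟨ε, hε, h⟩ := Metric.eventually_nhds_iff.1 h0
  have h1 := mem_simplex_iff.1 (h (y := ε / 2) (by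
    rw [Real.dist_eq, sub_zero, abs_of_pos (by positivity)]; linarith))
  have h2 := mem_simplex_iff.1 (h (y := -(ε / 2)) (by
    rw [Real.dist_eq, sub_zero, abs_neg, abs_of_pos (by positivity)]; linarith))
  have h3 := h2.1 i
  have h4 := h1.2
  have h5 := l1Norm_of_nonneg (mem_simplex_iff.1 (interior_subset hs)).1
  simp [Finset.sum_add_distrib, ← Finset.mul_sum] at h3 h4
  constructor <;> linarith

/-! ### The kernel with bandwidth `b` -/

/-- The normalising constant of the kernel with bandwidth `b`, where `r` is the last barycentric
coordinate. -/
noncomputable def kernelConst (s : Fin d → ℝ) (r b : ℝ) : ℝ :=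
  Real.Gamma (1 / b + d + 1) / (Real.Gamma (r / b + 1) * ∏ i, Real.Gamma (s i / b + 1))

lemma dirichletDensity_eq_kernelConst_mul {s : Fin d → ℝ} (hs : ∀ i, 0 < s i) {b : ℝ}
    (hb : 0 < b) (x : Fin d → ℝ) :
    dirichletDensity (1 / b) (fun j => s j + b) (1 - l1Norm s + b) x =
      kernelConst s (1 - l1Norm s) b *
        dirichletWeight (fun i => s i / b + 1) ((1 - l1Norm s) / b + 1) 1 x := by
  have h1 : ∀ y, 1 / b * (y + b) = y / b + 1 := fun y => by field_simp
  have h2 : 1 / b * l1Norm (fun j => s j + b) + 1 / b * (1 - l1Norm s + b) = 1 / b + d + 1 := by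
    rw [l1Norm_of_nonneg (fun i => (add_pos (hs i) hb).le), l1Norm_of_nonneg (fun i => (hs i).le),
      Finset.sum_add_distrib]
    simp
    field_simp
    ring
  rw [dirichletDensity_eq, h2, kernelConst]
  simp_rw [h1]

section Kernel

variable {s : Fin d → ℝ} {r b : ℝ} (hs : ∀ i, 0 < s i) (hr : 0 < r) (hsum : ∑ i, s i + r = 1)
  (hb : 0 < b)

include hs hr hb in
lemma kernelConst_pos : 0 < kernelConst s r b := by
  have h1 : ∀ i, 0 < Real.Gamma (s i / b + 1) := fun i =>
    Real.Gamma_pos_of_pos (by have := hs i; positivity)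
  have h2 := Real.Gamma_pos_of_pos (show 0 < r / b + 1 by positivity)
  have h3 := Real.Gamma_pos_of_pos (show 0 < 1 / b + d + 1 by positivity)
  have h4 : 0 < ∏ i, Real.Gamma (s i / b + 1) := Finset.prod_pos fun i _ => h1 i
  unfold kernelConst
  positivity

include hs hr hsum hb in
lemma kernelConst_mul_integral :
    kernelConst s r b * ∫ x, dirichletWeight (fun i => s i / b + 1) (r / b + 1) 1 x = 1 := by
  have h1 : ∀ i, 0 < Real.Gamma (s i / b + 1) := fun i =>
    Real.Gamma_pos_of_pos (by have := hs i; positivity)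
  have h2 := Real.Gamma_pos_of_pos (show 0 < r / b + 1 by positivity)
  have h3 := Real.Gamma_pos_of_pos (show 0 < 1 / b + d + 1 by positivity)
  have h4 : 0 < ∏ i, Real.Gamma (s i / b + 1) := Finset.prod_pos fun i _ => h1 i
  have h5 : ∑ i, (s i / b + 1) + (r / b + 1) = 1 / b + d + 1 := by
    rw [Finset.sum_add_distrib, ← Finset.sum_div, eq_sub_of_add_eq hsum]
    simp
    ring
  rw [integral_dirichletWeight (fun i => by have := hs i; positivity) (by positivity), h5,
    kernelConst]
  generalize ∏ i, Real.Gamma (s i / b + 1) = q at *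
  field_simp

include hsum in
lemma sum_two_mul_div_add_one :
    ∑ i, (2 * (s i / b) + 1) + (2 * (r / b) + 1) = 2 * (1 / b) + d + 1 := by
  rw [Finset.sum_add_distrib, ← Finset.mul_sum, ← Finset.sum_div, eq_sub_of_add_eq hsum]
  simp
  ring

include hs hr hsum hb in
lemma kernelConst_sq_mul_integral :
    kernelConst s r b ^ 2 *
      ∫ x, dirichletWeight (fun i => 2 * (s i / b) + 1) (2 * (r / b) + 1) 1 x =
      kernelSqMass s r b := by
  have h1 : ∀ i, 0 < Real.Gamma (s i / b + 1) := fun i =>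
    Real.Gamma_pos_of_pos (by have := hs i; positivity)
  have h2 := Real.Gamma_pos_of_pos (show 0 < r / b + 1 by positivity)
  have h4 : 0 < ∏ i, Real.Gamma (s i / b + 1) := Finset.prod_pos fun i _ => h1 i
  have h6 := Real.Gamma_pos_of_pos (show 0 < 2 * (1 / b) + d + 1 by positivity)
  rw [integral_dirichletWeight (fun i => by have := hs i; positivity) (by positivity),
    sum_two_mul_div_add_one hsum, kernelConst, kernelSqMass, Finset.prod_div_distrib,
    Finset.prod_pow]
  field_simp

include hs hr hsum hb in
/-- The `Dirichlet(2 s / b + 1)` distribution has variance and squared bias about `s` of order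
`b`. -/
lemma integral_sub_sq_mul_le (hb1 : b ≤ 1) (j : Fin d) :
    ∫ x, (x j - s j) ^ 2 *
        dirichletWeight (fun i => 2 * (s i / b) + 1) (2 * (r / b) + 1) 1 x ≤
      (((d : ℝ) + 1) ^ 2 + 1) * b *
        ∫ x, dirichletWeight (fun i => 2 * (s i / b) + 1) (2 * (r / b) + 1) 1 x := by
  have hα : ∀ i, 0 < 2 * (s i / b) + 1 := fun i => by have := hs i; positivity
  have hβ : 0 < 2 * (r / b) + 1 := by positivity
  rw [(integral_sub_sq_mul_dirichletWeight hα hβ j (s j)).2, sum_two_mul_div_add_one hsum]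
  refine mul_le_mul_of_nonneg_right ?_ (integral_nonneg (dirichletWeight_nonneg _ _ _))
  have hsj := hs j
  have hsj1 : s j ≤ 1 := by
    have := Finset.single_le_sum (fun i _ => (hs i).le) (Finset.mem_univ j)
    linarith
  have hd : (1 : ℝ) ≤ d := by
    have := j.pos
    exact_mod_cast this
  set A : ℝ := 2 * (1 / b) + d + 1 with hA
  have hAb : 1 ≤ A * b := by
    have : A * b = 2 + (d + 1) * b := by rw [hA]; field_simp; ring
    rw [this]; nlinarith
  have hA0 : 0 < A := by positivity
  set p : ℝ := (2 * (s j / b) + 1) / A with hp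
  have hp0 : 0 ≤ p := by positivity
  have hp1 : p ≤ 1 := by
    rw [hp, div_le_one hA0, hA]
    have : s j / b ≤ 1 / b := by gcongr
    linarith
  have hbias : p - s j = (1 - s j * (d + 1)) / A := by
    rw [hp, hA]; field_simp; ring
  have e : (2 * (s j / b) + 1) * (2 * (s j / b) + 1 + 1) / (A * (A + 1)) - 2 * s j * p + s j ^ 2 =
      p * (1 - p) / (A + 1) + (p - s j) ^ 2 := by
    rw [hp]; field_simp; ring
  rw [e]
  have hv : p * (1 - p) / (A + 1) ≤ b := by
    rw [div_le_iff₀ (by positivity)]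
    nlinarith
  have hbias' : |p - s j| ≤ (d + 1) * b := by
    rw [hbias, abs_div, abs_of_pos hA0, div_le_iff₀ hA0]
    have h1 : |1 - s j * (d + 1)| ≤ d + 1 := by
      rw [abs_le]; constructor <;> nlinarith
    calc |1 - s j * (d + 1)| ≤ (d + 1) * 1 := by linarith
      _ ≤ (d + 1) * (A * b) := by gcongr
      _ = _ := by ring
  have hsq : (p - s j) ^ 2 ≤ ((d : ℝ) + 1) ^ 2 * b := by
    rw [← sq_abs]
    calc |p - s j| ^ 2 ≤ ((d + 1) * b) ^ 2 := by gcongr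
      _ = ((d : ℝ) + 1) ^ 2 * (b * b) := by ring
      _ ≤ ((d : ℝ) + 1) ^ 2 * (1 * b) := by gcongr
      _ = _ := by ring
  linarith

include hs hr hsum hb in
/-- The first absolute moment about `s`. Instead of the Cauchy-Schwarz inequality the proof uses
`2 |u| ≤ u² / √b + √b` pointwise. -/
lemma integral_abs_sub_mul_le (hb1 : b ≤ 1) (j : Fin d) :
    Integrable (fun x => |x j - s j| *
        dirichletWeight (fun i => 2 * (s i / b) + 1) (2 * (r / b) + 1) 1 x) ∧
    ∫ x, |x j - s j| * dirichletWeight (fun i => 2 * (s i / b) + 1) (2 * (r / b) + 1) 1 x ≤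
      ((((d : ℝ) + 1) ^ 2 + 2) / 2) * Real.sqrt b *
        ∫ x, dirichletWeight (fun i => 2 * (s i / b) + 1) (2 * (r / b) + 1) 1 x := by
  have hα : ∀ i, 0 < 2 * (s i / b) + 1 := fun i => by have := hs i; positivity
  have hβ : 0 < 2 * (r / b) + 1 := by positivity
  have hq := Real.sqrt_pos.2 hb
  have hqq := Real.sq_sqrt hb.le
  have h2 := (integral_sub_sq_mul_dirichletWeight hα hβ j (s j)).1
  have h3 := integral_sub_sq_mul_le hs hr hsum hb hb1 j
  have h0 := integrable_dirichletWeight hα hβ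
  have hnn := dirichletWeight_nonneg (fun i => 2 * (s i / b) + 1) (2 * (r / b) + 1) 1
  have hm : Measurable (dirichletWeight (fun i => 2 * (s i / b) + 1) (2 * (r / b) + 1) 1) := by
    fun_prop
  generalize dirichletWeight (fun i => 2 * (s i / b) + 1) (2 * (r / b) + 1) 1 = w at *
  have hbd : Integrable fun x =>
      1 / (2 * Real.sqrt b) * ((x j - s j) ^ 2 * w x) + Real.sqrt b / 2 * w x :=
    (h2.const_mul _).add (h0.const_mul _)
  have hpt : ∀ x, |x j - s j| * w x ≤
      1 / (2 * Real.sqrt b) * ((x j - s j) ^ 2 * w x) + Real.sqrt b / 2 * w x := by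
    intro x
    have : |x j - s j| ≤ 1 / (2 * Real.sqrt b) * (x j - s j) ^ 2 + Real.sqrt b / 2 := by
      rw [← sq_abs (x j - s j)]
      have h := sq_nonneg (|x j - s j| - Real.sqrt b)
      rw [div_mul_eq_mul_div, one_mul, div_add_div _ _ (by positivity) (by norm_num),
        le_div_iff₀ (by positivity)]
      nlinarith
    calc _ ≤ (1 / (2 * Real.sqrt b) * (x j - s j) ^ 2 + Real.sqrt b / 2) * w x :=
          mul_le_mul_of_nonneg_right this (hnn x)
      _ = _ := by ring
  have hI : Integrable fun x => |x j - s j| * w x := by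
    refine hbd.mono' (by fun_prop) (ae_of_all _ fun x => ?_)
    rw [Real.norm_of_nonneg (mul_nonneg (abs_nonneg _) (hnn x))]
    exact hpt x
  refine ⟨hI, ?_⟩
  calc _ ≤ ∫ x, (1 / (2 * Real.sqrt b) * ((x j - s j) ^ 2 * w x) + Real.sqrt b / 2 * w x) :=
        integral_mono hI hbd hpt
    _ = 1 / (2 * Real.sqrt b) * (∫ x, (x j - s j) ^ 2 * w x) + Real.sqrt b / 2 * ∫ x, w x := by
        rw [integral_add (h2.const_mul _) (h0.const_mul _), integral_const_mul, integral_const_mul]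
    _ ≤ 1 / (2 * Real.sqrt b) * ((((d : ℝ) + 1) ^ 2 + 1) * b * (∫ x, w x)) +
          Real.sqrt b / 2 * ∫ x, w x := by gcongr
    _ = _ := by
        nth_rewrite 2 [← hqq]
        field_simp
        ring

end Kernel

/-! ### Lipschitz densities on the simplex -/

section Density

variable {f : (Fin d → ℝ) → ℝ} {L : ℝ}

lemma LipschitzOnSimplex.continuousOn (hf : LipschitzOnSimplex L f) :
    ContinuousOn f (simplex d) := by
  intro x hx
  have h1 : Tendsto (fun y : Fin d → ℝ => L * l1Norm (y - x)) (𝓝[simplex d] x) (𝓝 0) := by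
    have : Continuous fun y : Fin d → ℝ => L * l1Norm (y - x) := by
      unfold l1Norm; fun_prop
    have h := this.tendsto x
    simp only [sub_self, l1Norm, Pi.zero_apply, abs_zero, Finset.sum_const_zero, mul_zero] at h
    exact h.mono_left nhdsWithin_le_nhds
  refine tendsto_iff_norm_sub_tendsto_zero.2 (squeeze_zero' (.of_forall fun _ => norm_nonneg _)
    ?_ h1)
  filter_upwards [self_mem_nhdsWithin] with y hy using hf y hy x hx

lemma LipschitzOnSimplex.aemeasurable (hf : LipschitzOnSimplex L f) :
    AEMeasurable f (volume.restrict (simplex d)) :=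
  hf.continuousOn.aemeasurable measurableSet_simplex

lemma integral_lawOfDensity (hf0 : ∀ x ∈ simplex d, 0 ≤ f x) (hf : LipschitzOnSimplex L f)
    (g : (Fin d → ℝ) → ℝ) :
    ∫ x, g x ∂(lawOfDensity f) = ∫ x in simplex d, f x * g x := by
  rw [lawOfDensity, integral_withDensity_eq_integral_toReal_smul₀ hf.aemeasurable.ennreal_ofReal
    (ae_of_all _ fun _ => ENNReal.ofReal_lt_top)]
  refine setIntegral_congr_fun measurableSet_simplex fun x hx => ?_
  simp [ENNReal.toReal_ofReal (hf0 x hx)]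

/-- A Lipschitz probability density on the simplex is bounded by a constant that depends on the
dimension and on the Lipschitz constant alone, because it is at least `f x - 2 |L|` everywhere. -/
lemma density_le [IsProbabilityMeasure (lawOfDensity f)] (hf : LipschitzOnSimplex L f)
    (hV : 0 < volume.real (simplex d)) {x : Fin d → ℝ} (hx : x ∈ simplex d) :
    f x ≤ 1 / volume.real (simplex d) + 2 * |L| := by
  have h1 : ENNReal.ofReal (f x - 2 * |L|) * volume (simplex d) ≤ 1 := by
    rw [← measure_univ (μ := lawOfDensity f), lawOfDensity, withDensity_apply _ MeasurableSet.univ,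
      Measure.restrict_univ, ← setLIntegral_const]
    refine setLIntegral_mono' measurableSet_simplex fun y hy => ENNReal.ofReal_le_ofReal ?_
    have h := (le_abs_self _).trans (hf x hx y hy)
    have : L * l1Norm (x - y) ≤ |L| * 2 :=
      mul_le_mul (le_abs_self _) (l1Norm_sub_le_two hx hy)
        (Finset.sum_nonneg fun _ _ => abs_nonneg _) (abs_nonneg _)
    linarith
  rcases le_or_gt (f x - 2 * |L|) 0 with h | h
  · have : 0 < 1 / volume.real (simplex d) := by positivity
    linarith
  · have h2 := ENNReal.toReal_mono ENNReal.one_ne_top h1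
    rw [ENNReal.toReal_mul, ENNReal.toReal_ofReal h.le, ENNReal.toReal_one] at h2
    have := (le_div_iff₀ hV).2 h2
    linarith

/-- Integrability of the product is included, because `f` is measurable only on the simplex. -/
lemma integral_simplex_mul_dirichletWeight_le {M : ℝ} {α : Fin d → ℝ} {β : ℝ}
    (hα : ∀ i, 0 < α i) (hβ : 0 < β) (hf0 : ∀ x ∈ simplex d, 0 ≤ f x)
    (hfm : AEMeasurable f (volume.restrict (simplex d))) (hM : ∀ x ∈ simplex d, f x ≤ M) :
    IntegrableOn (fun x => f x * dirichletWeight α β 1 x) (simplex d) ∧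
    ∫ x in simplex d, f x * dirichletWeight α β 1 x ≤ M * ∫ x, dirichletWeight α β 1 x := by
  have h0 := (integrable_dirichletWeight hα hβ).const_mul M
  have hI : IntegrableOn (fun x => f x * dirichletWeight α β 1 x) (simplex d) := by
    refine h0.integrableOn.mono' ?_ ?_
    · exact (hfm.mul (by fun_prop)).aestronglyMeasurable
    · filter_upwards [ae_restrict_mem measurableSet_simplex] with x hx
      rw [Real.norm_of_nonneg (mul_nonneg (hf0 x hx) (dirichletWeight_nonneg _ _ _ _))]
      exact mul_le_mul_of_nonneg_right (hM x hx) (dirichletWeight_nonneg _ _ _ _)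
  refine ⟨hI, ?_⟩
  rw [← integral_const_mul, ← setIntegral_eq_integral_of_forall_compl_eq_zero (s := simplex d)
    (f := fun x => M * dirichletWeight α β 1 x) fun x hx => by rw [dirichletWeight_of_notMem _ _ hx, mul_zero]]
  exact setIntegral_mono_on hI h0.integrableOn measurableSet_simplex fun x hx =>
    mul_le_mul_of_nonneg_right (hM x hx) (dirichletWeight_nonneg _ _ _ _)

/-- The mean of a Lipschitz function differs from its value at `s` by at most `|L|` times the mean
`ℓ¹` distance to `s`. -/
lemma abs_integral_sub_le {α : Fin d → ℝ} {β : ℝ} (hα : ∀ i, 0 < α i) (hβ : 0 < β)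
    (hf : LipschitzOnSimplex L f) {s : Fin d → ℝ} (hs : s ∈ simplex d)
    (hI : IntegrableOn (fun x => f x * dirichletWeight α β 1 x) (simplex d))
    (hJ : ∀ j, Integrable fun x => |x j - s j| * dirichletWeight α β 1 x) :
    |(∫ x in simplex d, f x * dirichletWeight α β 1 x) - f s * ∫ x, dirichletWeight α β 1 x| ≤
      |L| * ∑ j, ∫ x, |x j - s j| * dirichletWeight α β 1 x := by
  have h0 := (integrable_dirichletWeight hα hβ).const_mul (f s)
  have hS : Integrable fun x => |L| * ∑ j, |x j - s j| * dirichletWeight α β 1 x :=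
    (integrable_finsetSum _ fun j _ => hJ j).const_mul _
  rw [← integral_const_mul, ← setIntegral_eq_integral_of_forall_compl_eq_zero (s := simplex d)
    (f := fun x => f s * dirichletWeight α β 1 x)
    fun x hx => by rw [dirichletWeight_of_notMem _ _ hx, mul_zero],
    ← integral_sub hI h0.integrableOn, ← integral_finsetSum _ fun j _ => hJ j,
    ← integral_const_mul, ← Real.norm_eq_abs]
  refine (norm_integral_le_of_norm_le hS.integrableOn ?_).trans
    (setIntegral_le_integral hS (ae_of_all _ fun x => ?_))
  · filter_upwards [ae_restrict_mem measurableSet_simplex] with x hx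
    rw [← sub_mul, norm_mul, Real.norm_of_nonneg (dirichletWeight_nonneg _ _ _ _),
      ← Finset.sum_mul, ← mul_assoc]
    refine mul_le_mul_of_nonneg_right ((hf x hx s hs).trans ?_) (dirichletWeight_nonneg _ _ _ _)
    exact mul_le_mul_of_nonneg_right (le_abs_self L) (Finset.sum_nonneg fun _ _ => abs_nonneg _)
  · exact mul_nonneg (abs_nonneg _) (Finset.sum_nonneg fun j _ =>
      mul_nonneg (abs_nonneg _) (dirichletWeight_nonneg _ _ _ _))

end Density

/-! ### The variance of the estimator -/

lemma measurable_dirichletDensity (N : ℝ) (α : Fin d → ℝ) (β : ℝ) :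
    Measurable (dirichletDensity N α β) := by
  rw [funext (dirichletDensity_eq N α β)]
  fun_prop

/-- Variance of an average of independent variables with the same law. -/
lemma variance_average {Ω : Type*} [MeasurableSpace Ω] {P : Measure Ω} [IsProbabilityMeasure P]
    {E : Type*} [MeasurableSpace E] {μ : Measure E} {X : ℕ → Ω → E} (hX : iIndepFun X P)
    (hlaw : ∀ i, HasLaw (X i) μ P) {K : E → ℝ} (hK : Measurable K) {B : ℝ}
    (hB : ∀ x, |K x| ≤ B) {n : ℕ} (hn : 1 ≤ n) :
    MemLp (fun ω => (1 / (n : ℝ)) * ∑ i ∈ Finset.range n, K (X i ω)) 2 P ∧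
    variance (fun ω => (1 / (n : ℝ)) * ∑ i ∈ Finset.range n, K (X i ω)) P =
      (n : ℝ)⁻¹ * (∫ x, K x ^ 2 ∂μ - (∫ x, K x ∂μ) ^ 2) := by
  have hmem : ∀ i, MemLp (fun ω => K (X i ω)) 2 P := fun i =>
    MemLp.of_bound (hK.comp_aemeasurable (hlaw i).aemeasurable).aestronglyMeasurable B
      (ae_of_all _ fun ω => hB _)
  have hvar : ∀ i, variance (fun ω => K (X i ω)) P = ∫ x, K x ^ 2 ∂μ - (∫ x, K x ∂μ) ^ 2 := by
    intro i
    rw [variance_eq_sub (hmem i)]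
    congr 2
    · exact (hlaw i).integral_comp (f := fun x => K x ^ 2) (by fun_prop)
    · exact (hlaw i).integral_comp (f := K) (by fun_prop)
  refine ⟨(memLp_finsetSum _ fun i _ => hmem i).const_mul _, ?_⟩
  have hsum : variance (fun ω => ∑ i ∈ Finset.range n, K (X i ω)) P =
      ∑ i ∈ Finset.range n, variance (fun ω => K (X i ω)) P := by
    rw [← IndepFun.variance_sum (fun i _ => hmem i)
      fun i _ j _ hij => (hX.indepFun hij).comp hK hK]
    congr 1
    ext ω
    simp
  rw [variance_const_mul, hsum, Finset.sum_congr rfl fun i _ => hvar i, Finset.sum_const,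
    Finset.card_range, nsmul_eq_mul]
  have : (n : ℝ) ≠ 0 := by positivity
  field_simp

/-- The variance of the kernel under a Lipschitz density, uniformly over all densities with the
given Lipschitz constant. -/
lemma exists_variance_kernel_bound (hd : 1 ≤ d) {s : Fin d → ℝ}
    (hs : s ∈ interior (simplex d)) (L : ℝ) :
    ∃ C : ℝ, 0 < C ∧ ∃ b₀ : ℝ, 0 < b₀ ∧
      ∀ f : (Fin d → ℝ) → ℝ, (∀ x ∈ simplex d, 0 ≤ f x) → LipschitzOnSimplex L f →
        IsProbabilityMeasure (lawOfDensity f) → ∀ b : ℝ, 0 < b → b < b₀ →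
        |((∫ x, dirichletDensity (1 / b) (fun j => s j + b) (1 - l1Norm s + b) x ^ 2
              ∂(lawOfDensity f)) -
            (∫ x, dirichletDensity (1 / b) (fun j => s j + b) (1 - l1Norm s + b) x
              ∂(lawOfDensity f)) ^ 2) *
            (b ^ ((d : ℝ) / 2) * varianceConst s (1 - l1Norm s)) - f s| ≤
          C * Real.sqrt b := by
  have hs0 : ∀ i, 0 < s i := fun i => (pos_of_mem_interior_simplex hs i).1
  have hr : 0 < 1 - l1Norm s := by
    linarith [(pos_of_mem_interior_simplex hs ⟨0, hd⟩).2]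
  have hsum : ∑ i, s i + (1 - l1Norm s) = 1 := by
    rw [l1Norm_of_nonneg fun i => (hs0 i).le]; ring
  have hsS := interior_subset hs
  have hV : 0 < volume.real (simplex d) :=
    ENNReal.toReal_pos (Measure.measure_pos_of_nonempty_interior _ ⟨s, hs⟩).ne' volume_simplex_lt_top.ne
  obtain ⟨c, hc, b₁, hb₁, hA⟩ := kernelSqMass_asymptotic hs0 hr hsum
  set M : ℝ := 1 / volume.real (simplex d) + 2 * |L|
  have hM0 : 0 < M := by positivity
  set D : ℝ := varianceConst s (1 - l1Norm s) with hD
  have hD0 : 0 ≤ D := Real.sqrt_nonneg _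
  set κ : ℝ := |L| * (d * ((((d : ℝ) + 1) ^ 2 + 2) / 2)) with hκ
  have hκ0 : 0 ≤ κ := by positivity
  refine ⟨M * c + κ * (1 + c) + M ^ 2 * D, by positivity, min b₁ 1, by positivity, ?_⟩
  intro f hf0 hf hprob b hb hbb
  have hb1 : b ≤ 1 := (hbb.trans_le (min_le_right _ _)).le
  have hE := hA b hb (hbb.trans_le (min_le_left _ _))
  have hM : ∀ x ∈ simplex d, f x ≤ M := fun x hx => density_le hf hV hx
  have hα : ∀ i, 0 < s i / b + 1 := fun i => by have := hs0 i; positivity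
  have hβ : 0 < (1 - l1Norm s) / b + 1 := by positivity
  have hα' : ∀ i, 0 < 2 * (s i / b) + 1 := fun i => by have := hs0 i; positivity
  have hβ' : 0 < 2 * ((1 - l1Norm s) / b) + 1 := by positivity
  have hk := kernelConst_pos hs0 hr hb
  set k := kernelConst s (1 - l1Norm s) b with hkdef
  set A := kernelSqMass s (1 - l1Norm s) b with hAdef
  set w := dirichletWeight (fun i => s i / b + 1) ((1 - l1Norm s) / b + 1) 1 with hw
  set w' := dirichletWeight (fun i => 2 * (s i / b) + 1) (2 * ((1 - l1Norm s) / b) + 1) 1 with hw'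
  have hmass : k * ∫ x, w x = 1 := kernelConst_mul_integral hs0 hr hsum hb
  have hmass' : k ^ 2 * ∫ x, w' x = A := kernelConst_sq_mul_integral hs0 hr hsum hb
  have hfw := integral_simplex_mul_dirichletWeight_le hα hβ hf0 hf.aemeasurable hM
  have hfw' := integral_simplex_mul_dirichletWeight_le hα' hβ' hf0 hf.aemeasurable hM
  have hw0 : ∀ x, 0 ≤ w x := dirichletWeight_nonneg _ _ _
  have hw'0 : ∀ x, 0 ≤ w' x := dirichletWeight_nonneg _ _ _
  -- the mean of the kernel stays bounded
  have hmean : ∫ x, dirichletDensity (1 / b) (fun j => s j + b) (1 - l1Norm s + b) x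
      ∂(lawOfDensity f) = k * ∫ x in simplex d, f x * w x := by
    rw [integral_lawOfDensity hf0 hf, ← integral_const_mul]
    refine integral_congr_ae (ae_of_all _ fun x => ?_)
    simp only [dirichletDensity_eq_kernelConst_mul hs0 hb]
    ring
  have hmean0 : 0 ≤ k * ∫ x in simplex d, f x * w x :=
    mul_nonneg hk.le (setIntegral_nonneg measurableSet_simplex fun x hx =>
      mul_nonneg (hf0 x hx) (hw0 x))
  have hmeanM : k * ∫ x in simplex d, f x * w x ≤ M := by
    calc _ ≤ k * (M * ∫ x, w x) := mul_le_mul_of_nonneg_left hfw.2 hk.le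
      _ = M * (k * ∫ x, w x) := by ring
      _ = M := by rw [hmass, mul_one]
  -- the second moment is an integral against a Dirichlet density concentrated at `s`
  have hsq : ∫ x, dirichletDensity (1 / b) (fun j => s j + b) (1 - l1Norm s + b) x ^ 2
      ∂(lawOfDensity f) = k ^ 2 * ∫ x in simplex d, f x * w' x := by
    rw [integral_lawOfDensity hf0 hf, ← integral_const_mul]
    refine integral_congr_ae (ae_of_all _ fun x => ?_)
    have e : w x ^ 2 = w' x := by
      rw [hw, hw', dirichletWeight_sq]
      congr 1
      · funext i
        ring
      · ring
    simp only [dirichletDensity_eq_kernelConst_mul hs0 hb]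
    rw [mul_pow, ← hw, ← hkdef, e]
    ring
  have hq := Real.sqrt_pos.2 hb
  have hqq := Real.sq_sqrt hb.le
  have hq1 : Real.sqrt b ≤ 1 := by
    simpa using Real.sqrt_le_sqrt hb1
  have hdev : |k ^ 2 * (∫ x in simplex d, f x * w' x) - f s * A| ≤ κ * Real.sqrt b * A := by
    have h1 := abs_integral_sub_le hα' hβ' hf hsS hfw'.1
      fun j => (integral_abs_sub_mul_le hs0 hr hsum hb hb1 j).1
    have h2 : ∑ j, ∫ x, |x j - s j| * w' x ≤
        d * ((((d : ℝ) + 1) ^ 2 + 2) / 2 * Real.sqrt b * ∫ x, w' x) := by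
      refine (Finset.sum_le_sum fun j _ =>
        (integral_abs_sub_mul_le hs0 hr hsum hb hb1 j).2).trans_eq ?_
      simp [hw']
    rw [← hmass', show k ^ 2 * (∫ x in simplex d, f x * w' x) - f s * (k ^ 2 * ∫ x, w' x) =
      k ^ 2 * ((∫ x in simplex d, f x * w' x) - f s * ∫ x, w' x) by ring, abs_mul,
      abs_of_pos (by positivity : 0 < k ^ 2)]
    calc _ ≤ k ^ 2 * (|L| * (d * ((((d : ℝ) + 1) ^ 2 + 2) / 2 * Real.sqrt b * ∫ x, w' x))) := by
          refine mul_le_mul_of_nonneg_left (h1.trans ?_) (by positivity)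
          exact mul_le_mul_of_nonneg_left h2 (abs_nonneg _)
      _ = _ := by rw [hκ]; ring
  rw [hmean, hsq]
  generalize k * (∫ x in simplex d, f x * w x) = m at *
  generalize k ^ 2 * (∫ x in simplex d, f x * w' x) = q at *
  have hA0 : 0 ≤ A := by
    rw [← hmass']
    exact mul_nonneg (sq_nonneg _) (integral_nonneg hw'0)
  have hfs0 := hf0 s hsS
  have hfsM := hM s hsS
  have hbd0 : 0 ≤ b ^ ((d : ℝ) / 2) := by positivity
  have hbq : b ≤ Real.sqrt b := by nlinarith
  -- because `1 ≤ d`, the squared mean contributes no more than the order `√b` of the error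
  have hbd : b ^ ((d : ℝ) / 2) ≤ Real.sqrt b := by
    rw [Real.sqrt_eq_rpow]
    refine Real.rpow_le_rpow_of_exponent_ge hb hb1 ?_
    have : (1 : ℝ) ≤ d := by exact_mod_cast hd
    linarith
  have hE1 : A * (b ^ ((d : ℝ) / 2) * D) ≤ 1 + c := by
    have := (abs_le.1 hE).2
    nlinarith
  have split : (q - m ^ 2) * (b ^ ((d : ℝ) / 2) * D) - f s =
      f s * (A * (b ^ ((d : ℝ) / 2) * D) - 1) + (q - f s * A) * (b ^ ((d : ℝ) / 2) * D) -
        m ^ 2 * (b ^ ((d : ℝ) / 2) * D) := by ring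
  have t1 : |f s * (A * (b ^ ((d : ℝ) / 2) * D) - 1)| ≤ M * c * Real.sqrt b := by
    rw [abs_mul, abs_of_nonneg hfs0]
    calc _ ≤ M * (c * b) := mul_le_mul hfsM hE (abs_nonneg _) hM0.le
      _ ≤ M * (c * Real.sqrt b) := by gcongr
      _ = _ := by ring
  have t2 : |(q - f s * A) * (b ^ ((d : ℝ) / 2) * D)| ≤ κ * (1 + c) * Real.sqrt b := by
    rw [abs_mul, abs_of_nonneg (by positivity : 0 ≤ b ^ ((d : ℝ) / 2) * D)]
    calc _ ≤ κ * Real.sqrt b * A * (b ^ ((d : ℝ) / 2) * D) := by gcongr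
      _ = κ * Real.sqrt b * (A * (b ^ ((d : ℝ) / 2) * D)) := by ring
      _ ≤ κ * Real.sqrt b * (1 + c) := by gcongr
      _ = _ := by ring
  have t3 : |m ^ 2 * (b ^ ((d : ℝ) / 2) * D)| ≤ M ^ 2 * D * Real.sqrt b := by
    rw [abs_of_nonneg (by positivity)]
    calc _ ≤ M ^ 2 * (Real.sqrt b * D) := by gcongr
      _ = _ := by ring
  rw [split]
  refine (abs_sub _ _).trans ((add_le_add (abs_add_le _ _) le_rfl).trans ?_)
  linarith

end DirichletKernel

theorem theorem3 (d : ℕ) (hd : 1 ≤ d) (s : Fin d → ℝ)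
    (hs : s ∈ interior (DirichletKernel.simplex d)) (L : ℝ) :
    ∃ C : ℝ, 0 < C ∧ ∃ b₀ : ℝ, 0 < b₀ ∧
      ∀ f : (Fin d → ℝ) → ℝ,
        (∀ x ∈ DirichletKernel.simplex d, 0 ≤ f x) →
        DirichletKernel.LipschitzOnSimplex L f →
      ∀ (Ω : Type*) [MeasurableSpace Ω] (P : Measure Ω) [IsProbabilityMeasure P]
        (X : ℕ → Ω → Fin d → ℝ),
        iIndepFun X P →
        (∀ i, HasLaw (X i) (DirichletKernel.lawOfDensity f) P) →
      ∀ (n : ℕ) (b : ℝ), 1 ≤ n → 0 < b → b < b₀ →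
        MemLp (DirichletKernel.kernelEstimator X n b s) 2 P ∧
        ∃ R : ℝ, |R| ≤ C * b ^ (1 / 2 : ℝ) ∧
          variance (DirichletKernel.kernelEstimator X n b s) P =
            (n : ℝ)⁻¹ * b ^ (-(d : ℝ) / 2) * (f s + R) /
              Real.sqrt ((4 * Real.pi) ^ d * ((∏ i, s i) * (1 - DirichletKernel.l1Norm s))) := by
  obtain ⟨C, hC, b₀, hb₀, h⟩ := DirichletKernel.exists_variance_kernel_bound hd hs L
  refine ⟨C, hC, b₀, hb₀, ?_⟩
  intro f hf0 hf Ω _ P _ X hX hlaw n b hn hb hbb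
  have hs0 : ∀ i, 0 < s i := fun i => (DirichletKernel.pos_of_mem_interior_simplex hs i).1
  have hr : 0 < 1 - DirichletKernel.l1Norm s := by
    linarith [(DirichletKernel.pos_of_mem_interior_simplex hs ⟨0, hd⟩).2]
  have hprob : IsProbabilityMeasure (DirichletKernel.lawOfDensity f) :=
    (hlaw 0).map_eq ▸ Measure.isProbabilityMeasure_map (hlaw 0).aemeasurable
  have hk := DirichletKernel.kernelConst_pos hs0 hr hb
  have hB : ∀ x, |DirichletKernel.dirichletDensity (1 / b) (fun j => s j + b)
      (1 - DirichletKernel.l1Norm s + b) x| ≤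
        DirichletKernel.kernelConst s (1 - DirichletKernel.l1Norm s) b := by
    intro x
    rw [DirichletKernel.dirichletDensity_eq_kernelConst_mul hs0 hb, abs_of_nonneg
      (mul_nonneg hk.le (DirichletKernel.dirichletWeight_nonneg _ _ _ _))]
    refine mul_le_of_le_one_right hk.le (DirichletKernel.dirichletWeight_le_one (fun i => ?_) ?_ x)
    · have := div_pos (hs0 i) hb
      linarith
    · have := div_pos hr hb
      linarith
  obtain ⟨hmem, hvar⟩ := DirichletKernel.variance_average hX hlaw
    (DirichletKernel.measurable_dirichletDensity _ _ _) hB hn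
  have hR := h f hf0 hf hprob b hb hbb
  rw [Real.sqrt_eq_rpow b] at hR
  refine ⟨hmem, _, hR, ?_⟩
  have hps : 0 < ∏ i, s i := Finset.prod_pos fun i _ => hs0 i
  have hD : 0 < DirichletKernel.varianceConst s (1 - DirichletKernel.l1Norm s) :=
    Real.sqrt_pos.2 (by positivity)
  have hbd : 0 < b ^ ((d : ℝ) / 2) := by positivity
  change variance (fun ω => (1 / (n : ℝ)) * ∑ i ∈ Finset.range n, _) P =
    _ / DirichletKernel.varianceConst s (1 - DirichletKernel.l1Norm s)
  rw [hvar, neg_div, Real.rpow_neg hb.le]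
  field_simp
  ring
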